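/- Let $R$ be a commutative noetherian local ring of depth $d$, and assume that $d>0$ or that $\dim R=0$. Suppose that: - $R$ is generically Gorenstein, i.e. $R_{\mathfrak p}$ is Gorenstein (has finite injective dimension over itself) for every minimal prime $\mathfrak p$ of $R$; - $R$ satisfies Serre's condition $(S_d)$, i.e. $\operatorname{depth} R_{\mathfrak p}\ge\min\{d,\dim R_{\mathfrak p}\}$ for every prime ideal $\mathfrak p$ of $R$; - $R$ satisfies $(ES_1^R)$, i.e. every finitely generated $R$-module $X$ with $\operatorname{Ext}^i_R(X,R)=0$ for all $i>0$ satisfies $\operatorname{depth} X_{\mathfrak p}\ge\min\{1,\operatorname{depth} R_{\mathfrak p}\}$ for every prime ideal $\mathfrak p$ of $R$ (the zero module has depth $\infty$). Let $M$ be a finitely generated $R$-module with $\operatorname{Ext}^i_R(M,R)=0$ for all $i>0$. Then $M$ is totally reflexive: writing $M^*=\operatorname{Hom}_R(M,R)$, the natural map $M\to M^{**}$ is an isomorphism and $\operatorname{Ext}^i_R(M,R)=0=\operatorname{Ext}^i_R(M^*,R)$ for all $i>0$. -/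

import Mathlib

universe u

open CategoryTheory

/-- The depth of a finitely generated module `M` over a noetherian local ring `R`: the supremum of
the lengths of the `M`-regular sequences in the maximal ideal. For `M ≠ 0` weakly regular sequences
in the maximal ideal are regular (Nakayama); the zero module has depth `∞`, as usual. -/
noncomputable def moduleDepth (R : Type u) [CommRing R] [IsLocalRing R]
    (M : Type u) [AddCommGroup M] [Module R M] : ℕ∞ :=
  ⨆ (rs : List R) (_ : ∀ r ∈ rs, r ∈ IsLocalRing.maximalIdeal R)
    (_ : RingTheory.Sequence.IsWeaklyRegular M rs), (rs.length : ℕ∞)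

/-- The depth of the localization `M_p` as a module over the local ring `R_p`. -/
noncomputable def depthAt (R : Type u) [CommRing R] (p : Ideal R) [p.IsPrime]
    (M : Type u) [AddCommGroup M] [Module R M] : ℕ∞ :=
  moduleDepth (Localization.AtPrime p) (LocalizedModule.AtPrime p M)

/-- Serre's condition `(S_n)`: `depth M_p ≥ min {n, dim R_p}` for all primes `p` of `R`. -/
def SatisfiesSerre (R : Type u) [CommRing R] (n : ℕ)
    (M : Type u) [AddCommGroup M] [Module R M] : Prop :=
  ∀ (p : Ideal R) [p.IsPrime],
    min ((n : ℕ∞) : WithBot ℕ∞) (ringKrullDim (Localization.AtPrime p)) ≤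
      (depthAt R p M : WithBot ℕ∞)

/-- The condition `(S̃_n)`: `depth M_p ≥ min {n, depth R_p}` for all primes `p` of `R`. -/
def SatisfiesSerreTilde (R : Type u) [CommRing R] (n : ℕ)
    (M : Type u) [AddCommGroup M] [Module R M] : Prop :=
  ∀ (p : Ideal R) [p.IsPrime],
    min (n : ℕ∞) (moduleDepth (Localization.AtPrime p) (Localization.AtPrime p)) ≤ depthAt R p M

/-- `Ext^i_R(M, N) = 0` for all `i > 0`. -/
def ExtPosVanishes (R : Type u) [CommRing R] (M N : Type u) [AddCommGroup M] [Module R M]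
    [AddCommGroup N] [Module R N] : Prop :=
  ∀ i : ℕ, 0 < i → Subsingleton (Abelian.Ext (ModuleCat.of R M) (ModuleCat.of R N) i)

/-- The condition `(ES_n^C)`: every finitely generated `R`-module `X` with `Ext^{>0}_R(X, C) = 0`
satisfies `(S̃_n)`. -/
def SatisfiesES (R : Type u) [CommRing R] (C : Type u) [AddCommGroup C] [Module R C]
    (n : ℕ) : Prop :=
  ∀ (X : Type u) [AddCommGroup X] [Module R X] [Module.Finite R X],
    ExtPosVanishes R X C → SatisfiesSerreTilde R n X

/-- A noetherian local ring is Gorenstein if it has finite injective dimension over itself. -/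
def IsGorensteinLocal (R : Type u) [CommRing R] [IsLocalRing R] : Prop :=
  IsNoetherianRing R ∧ injectiveDimension (ModuleCat.of R R) ≠ ⊤

/-- `R` is generically Gorenstein if `R_p` is Gorenstein for every minimal prime `p` of `R`. -/
def IsGenericallyGorenstein (R : Type u) [CommRing R] : Prop :=
  ∀ (p : Ideal R) [p.IsPrime], p ∈ minimalPrimes R → IsGorensteinLocal (Localization.AtPrime p)

/-- A (finitely generated) module `M` is totally reflexive if the natural map `M → M^{**}` is an
isomorphism and `Ext^{>0}_R(M, R) = 0 = Ext^{>0}_R(M^*, R)`. -/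
def IsTotallyReflexive (R : Type u) [CommRing R] (M : Type u) [AddCommGroup M]
    [Module R M] : Prop :=
  Function.Bijective (Module.Dual.eval R M) ∧
    ExtPosVanishes R M R ∧ ExtPosVanishes R (Module.Dual R M) R

/-!
Let `X` be a finitely generated module with `Ext^{>0}(X, R) = 0`. By `(ES_1)` and `(S_1)` its
associated primes are minimal primes of `R`. At such a prime the local ring is artinian of finite
injective dimension, hence self-injective, so every module over it is torsionless; a nonzero kernel
of `X → X**` would have an associated prime `p`, at which a linear form on `X_p` not killing it
lifts to `X`. So `X` is torsionless.

Dualising a surjection from a finite free module onto `X*` now embeds `X` in a finite free module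
`F` in such a way that every linear form on `X` extends to `F`. Then `Y = F / X` again satisfies
`Ext^{>0}(Y, R) = 0`, so `Y` is torsionless, which forces `X → X**` to be surjective. Thus `Y` is
reflexive as well, and the dual sequence `0 → Y* → F* → X* → 0` gives `Ext^1(X*, R) = 0` and
`Ext^{n+1}(X*, R) = Ext^n(Y*, R)`, whence the vanishing for all such `X` by induction on `n`.
-/

section Ext

open Abelian

section AbelianCategory

variable {C : Type*} [Category* C] [Abelian C] [HasExt C] {S : ShortComplex C}

theorem subsingleton_ext_X₁ (hS : S.ShortExact) (N : C) (n : ℕ) [Subsingleton (Ext S.X₂ N n)]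
    [Subsingleton (Ext S.X₃ N (n + 1))] : Subsingleton (Ext S.X₁ N n) := by
  refine subsingleton_of_forall_eq 0 fun x ↦ ?_
  obtain ⟨y, rfl⟩ := Ext.contravariant_sequence_exact₁ hS N x (n₁ := n + 1) (add_comm _ _)
    (Subsingleton.elim _ _)
  rw [Subsingleton.elim y 0, Ext.comp_zero]

theorem subsingleton_ext_X₂ (hS : S.ShortExact) (N : C) (n : ℕ) [Subsingleton (Ext S.X₁ N n)]
    [Subsingleton (Ext S.X₃ N n)] : Subsingleton (Ext S.X₂ N n) := by
  refine subsingleton_of_forall_eq 0 fun x ↦ ?_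
  obtain ⟨y, rfl⟩ := Ext.contravariant_sequence_exact₂ hS N x (Subsingleton.elim _ _)
  rw [Subsingleton.elim y 0, Ext.comp_zero]

theorem subsingleton_ext_succ_X₃ (hS : S.ShortExact) [Projective S.X₂] (N : C) (n : ℕ)
    [Subsingleton (Ext S.X₁ N n)] : Subsingleton (Ext S.X₃ N (n + 1)) := by
  refine subsingleton_of_forall_eq 0 fun x ↦ ?_
  obtain ⟨y, rfl⟩ := Ext.contravariant_sequence_exact₃ hS N x (Ext.eq_zero_of_projective _)
    (add_comm 1 n)
  rw [Subsingleton.elim y 0, Ext.comp_zero]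

theorem subsingleton_ext_one_X₃_iff (hS : S.ShortExact) [Projective S.X₂] (N : C) :
    Subsingleton (Ext S.X₃ N 1) ↔ Function.Surjective fun ψ : S.X₂ ⟶ N ↦ S.f ≫ ψ := by
  refine ⟨fun _ φ ↦ ?_, fun hsurj ↦ subsingleton_of_forall_eq 0 fun x ↦ ?_⟩
  · obtain ⟨y, hy⟩ := Ext.contravariant_sequence_exact₁ hS N (Ext.mk₀ φ) (n₁ := 1) rfl
      (Subsingleton.elim _ _)
    obtain ⟨ψ, rfl⟩ := (Ext.mk₀_bijective _ _).2 y
    exact ⟨ψ, (Ext.mk₀_bijective _ _).1 (by rw [← hy, Ext.mk₀_comp_mk₀])⟩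
  · obtain ⟨y, rfl⟩ := Ext.contravariant_sequence_exact₃ hS N x (Ext.eq_zero_of_projective _)
      (n₀ := 0) rfl
    obtain ⟨φ, rfl⟩ := (Ext.mk₀_bijective _ _).2 y
    obtain ⟨ψ, rfl⟩ := hsurj φ
    rw [← Ext.mk₀_comp_mk₀]
    exact hS.extClass_comp_assoc _

end AbelianCategory

variable {R : Type u} [CommRing R] {X Y Z : Type u} [AddCommGroup X] [Module R X]
  [AddCommGroup Y] [Module R Y] [AddCommGroup Z] [Module R Z] {f : X →ₗ[R] Y} {g : Y →ₗ[R] Z}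

theorem shortExact_of_exact (hf : Function.Injective f) (hg : Function.Surjective g)
    (h : Function.Exact f g) :
    (ModuleCat.shortComplexOfCompEqZero f g h.linearMap_comp_eq_zero).ShortExact :=
  ModuleCat.shortComplex_shortExact _ h hf hg

variable (N : Type u) [AddCommGroup N] [Module R N]

theorem subsingleton_ext_succ_of_exact [Module.Projective R Y] (hf : Function.Injective f)
    (hg : Function.Surjective g) (h : Function.Exact f g) (n : ℕ)
    [Subsingleton (Ext (ModuleCat.of R X) (ModuleCat.of R N) n)] :
    Subsingleton (Ext (ModuleCat.of R Z) (ModuleCat.of R N) (n + 1)) :=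
  subsingleton_ext_succ_X₃ (shortExact_of_exact hf hg h) (ModuleCat.of R N) n

theorem subsingleton_ext_one_iff_of_exact [Module.Projective R Y] (hf : Function.Injective f)
    (hg : Function.Surjective g) (h : Function.Exact f g) :
    Subsingleton (Ext (ModuleCat.of R Z) (ModuleCat.of R N) 1) ↔
      Function.Surjective (LinearMap.lcomp R N f) := by
  rw [subsingleton_ext_one_X₃_iff (shortExact_of_exact hf hg h) (ModuleCat.of R N)]
  refine ⟨fun hsurj φ ↦ ?_, fun hsurj φ ↦ ?_⟩
  · obtain ⟨ψ, hψ⟩ := hsurj (ModuleCat.ofHom φ)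
    exact ⟨ψ.hom, congrArg ModuleCat.Hom.hom hψ⟩
  · obtain ⟨ψ, hψ⟩ := hsurj φ.hom
    exact ⟨ModuleCat.ofHom ψ, ModuleCat.hom_ext hψ⟩

theorem extPosVanishes_of_exact [Module.Projective R Y] (hf : Function.Injective f)
    (hg : Function.Surjective g) (h : Function.Exact f g) (hX : ExtPosVanishes R X N)
    (hN : Function.Surjective (LinearMap.lcomp R N f)) : ExtPosVanishes R Z N := by
  rintro (_ | _ | n) hn
  · exact absurd hn (lt_irrefl 0)
  · exact (subsingleton_ext_one_iff_of_exact N hf hg h).2 hN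
  · have := hX (n + 1) n.succ_pos
    exact subsingleton_ext_succ_of_exact N hf hg h (n + 1)

end Ext

section Torsionless

open Module

/-- A module is torsionless, in the sense of Bass, if its elements are separated by linear forms. -/
def IsTorsionless (R M : Type*) [CommRing R] [AddCommGroup M] [Module R M] : Prop :=
  Function.Injective (Dual.eval R M)

section

variable {R : Type*} [CommRing R] {X P : Type*} [AddCommGroup X] [Module R X] [AddCommGroup P]
  [Module R P] {π : P →ₗ[R] Dual R X}

theorem IsTorsionless.injective_flip (hX : IsTorsionless R X) (hπ : Function.Surjective π) :
    Function.Injective π.flip :=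
  fun _ _ h ↦ hX (LinearMap.ext (hπ.forall.2 (LinearMap.congr_fun h)))

theorem surjective_dualMap_flip (hπ : Function.Surjective π) :
    Function.Surjective π.flip.dualMap :=
  hπ.forall.2 fun c ↦ ⟨Dual.eval R P c, rfl⟩

variable {F Y : Type*} [AddCommGroup F] [Module R F] [AddCommGroup Y] [Module R Y]
  {i : X →ₗ[R] F} {p : F →ₗ[R] Y}

theorem surjective_dual_eval_of_exact [IsReflexive R F] (h : Function.Exact i p)
    (hi : Function.Surjective i.dualMap) (hY : IsTorsionless R Y) :
    Function.Surjective (Dual.eval R X) := by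
  intro α
  obtain ⟨v, hv⟩ := (bijective_dual_eval R F).2 (i.dualMap.dualMap α)
  have hpv : p v = 0 := hY <| LinearMap.ext fun φ ↦ by
    have hφ : i.dualMap (p.dualMap φ) = 0 :=
      LinearMap.ext fun x ↦ by simp [h.apply_apply_eq_zero]
    calc φ (p v) = α (i.dualMap (p.dualMap φ)) := LinearMap.congr_fun hv (p.dualMap φ)
      _ = Dual.eval R Y 0 φ := by rw [hφ, map_zero, map_zero, LinearMap.zero_apply]
  obtain ⟨x, rfl⟩ := (h v).1 hpv
  refine ⟨x, LinearMap.dualMap_injective_of_surjective hi ?_⟩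
  rw [← hv, ← LinearMap.comp_apply, Dual.eval_naturality, LinearMap.comp_apply]

theorem surjective_dualMap_dualMap (hp : Function.Surjective p)
    (hY : Function.Surjective (Dual.eval R Y)) : Function.Surjective p.dualMap.dualMap := by
  have h := hY.comp hp
  rw [← LinearMap.coe_comp, ← Dual.eval_naturality, LinearMap.coe_comp] at h
  exact h.of_comp

end

variable {R : Type u} [CommRing R]

/-- Every finitely generated module in the left orthogonal `⊥R = {X | Ext^{>0}(X, R) = 0}` of `R`
is torsionless. This is what the hypotheses on depth and on the localizations of `R` provide, and
it makes all these modules totally reflexive. -/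
def PerpIsTorsionless (R : Type u) [CommRing R] : Prop :=
  ∀ (X : Type u) [AddCommGroup X] [Module R X] [Module.Finite R X],
    ExtPosVanishes R X R → IsTorsionless R X

variable [IsNoetherianRing R]

theorem IsTorsionless.exists_embedding {X : Type u} [AddCommGroup X] [Module R X]
    [Module.Finite R X] (hX : IsTorsionless R X) :
    ∃ (n : ℕ) (i : X →ₗ[R] Dual R (Fin n → R)),
      Function.Injective i ∧ Function.Surjective i.dualMap := by
  obtain ⟨n, π, hπ⟩ := Module.Finite.exists_fin' R (Dual R X)
  exact ⟨n, π.flip, hX.injective_flip hπ, surjective_dualMap_flip hπ⟩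

namespace PerpIsTorsionless

variable (hR : PerpIsTorsionless R)

include hR

theorem exists_embedding {X : Type u} [AddCommGroup X] [Module R X] [Module.Finite R X]
    (hX : ExtPosVanishes R X R) :
    ∃ (n : ℕ) (i : X →ₗ[R] Dual R (Fin n → R)), Function.Injective i ∧
      Function.Surjective i.dualMap ∧
      ExtPosVanishes R (Dual R (Fin n → R) ⧸ LinearMap.range i) R := by
  obtain ⟨n, i, hi, hdual⟩ := (hR X hX).exists_embedding
  exact ⟨n, i, hi, hdual,
    extPosVanishes_of_exact R hi (Submodule.mkQ_surjective _) i.exact_map_mkQ_range hX hdual⟩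

theorem bijective_dual_eval {X : Type u} [AddCommGroup X] [Module R X] [Module.Finite R X]
    (hX : ExtPosVanishes R X R) : Function.Bijective (Dual.eval R X) := by
  obtain ⟨n, i, -, hdual, hY⟩ := hR.exists_embedding hX
  exact ⟨hR X hX, surjective_dual_eval_of_exact i.exact_map_mkQ_range hdual (hR _ hY)⟩

theorem subsingleton_ext_dual (n : ℕ) (X : Type u) [AddCommGroup X] [Module R X]
    [Module.Finite R X] (hX : ExtPosVanishes R X R) :
    Subsingleton (Abelian.Ext (ModuleCat.of R (Dual R X)) (ModuleCat.of R R) (n + 1)) := by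
  obtain ⟨m, i, -, hdual, hY⟩ := hR.exists_embedding hX
  have hp := Submodule.mkQ_surjective (LinearMap.range i)
  have hp' := LinearMap.dualMap_injective_of_surjective hp
  have hexact : Function.Exact (LinearMap.range i).mkQ.dualMap i.dualMap :=
    LinearMap.exact_lcomp_of_exact_of_surjective R i.exact_map_mkQ_range hp
  match n with
  | 0 =>
    exact (subsingleton_ext_one_iff_of_exact R hp' hdual hexact).2
      (surjective_dualMap_dualMap hp (hR.bijective_dual_eval hY).2)
  | n + 1 =>
    have := subsingleton_ext_dual n _ hY
    exact subsingleton_ext_succ_of_exact R hp' hdual hexact (n + 1)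

theorem isTotallyReflexive {M : Type u} [AddCommGroup M] [Module R M] [Module.Finite R M]
    (hM : ExtPosVanishes R M R) : IsTotallyReflexive R M := by
  refine ⟨hR.bijective_dual_eval hM, hM, ?_⟩
  rintro (_ | n) hn
  · exact absurd hn (lt_irrefl 0)
  · exact hR.subsingleton_ext_dual n M hM

end PerpIsTorsionless

end Torsionless

section Artinian

theorem exists_injective_quotient_prime (A : Type*) [CommRing A] [IsArtinianRing A] (p : Ideal A)
    [hp : p.IsPrime] : ∃ f : A ⧸ p →ₗ[A] A, Function.Injective f := by
  have hmin : p ∈ (Module.annihilator A A).minimalPrimes :=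
    Ring.KrullDimLE.mem_minimalPrimes_iff.2
      ⟨hp, (Module.annihilator_eq_bot.2 inferInstance).trans_le bot_le⟩
  have hass : IsAssociatedPrime p A :=
    Module.associatedPrimes.minimalPrimes_annihilator_subset_associatedPrimes A A hmin
  exact ((isAssociatedPrime_iff_exists_injective_linearMap p A).1 hass).2

variable {A : Type u} [CommRing A] [IsArtinianRing A]

section

variable {N : Type u} [AddCommGroup N] [Module A N]

theorem subsingleton_ext_of_succ {n : ℕ}
    [Subsingleton (Abelian.Ext (ModuleCat.of A A) (ModuleCat.of A N) n)]
    (h : ∀ (X : Type u) [AddCommGroup X] [Module A X] [Module.Finite A X],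
      Subsingleton (Abelian.Ext (ModuleCat.of A X) (ModuleCat.of A N) (n + 1)))
    (X : Type u) [AddCommGroup X] [Module A X] [Module.Finite A X] :
    Subsingleton (Abelian.Ext (ModuleCat.of A X) (ModuleCat.of A N) n) := by
  induction ‹Module.Finite A X› using
    IsNoetherianRing.induction_on_isQuotientEquivQuotientPrime A with
  | subsingleton X =>
    have hX : Limits.IsZero (ModuleCat.of A X) := ModuleCat.isZero_of_subsingleton _
    refine subsingleton_of_forall_eq 0 fun x ↦ ?_
    rw [← Abelian.Ext.mk₀_id_comp x, hX.eq_zero_of_src (𝟙 _), Abelian.Ext.mk₀_zero,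
      Abelian.Ext.zero_comp]
  | quotient X p e =>
    obtain ⟨f, hf⟩ := exists_injective_quotient_prime A p.1
    have hfe : Function.Injective (f ∘ₗ e.toLinearMap) := hf.comp e.injective
    have := h (A ⧸ LinearMap.range (f ∘ₗ e.toLinearMap))
    exact subsingleton_ext_X₁ (shortExact_of_exact hfe (Submodule.mkQ_surjective _)
      (LinearMap.exact_map_mkQ_range _)) (ModuleCat.of A N) n
  | exact X₁ X₂ X₃ f g hf hg hfg h₁ h₃ =>
    exact subsingleton_ext_X₂ (shortExact_of_exact hf hg hfg) (ModuleCat.of A N) n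

theorem injective_of_subsingleton_ext_succ {n : ℕ}
    (h : ∀ (X : Type u) [AddCommGroup X] [Module A X] [Module.Finite A X],
      Subsingleton (Abelian.Ext (ModuleCat.of A X) (ModuleCat.of A N) (n + 1))) :
    Module.Injective A N := by
  induction n with
  | zero =>
    refine Module.Baer.injective fun I φ ↦ ?_
    obtain ⟨ψ, rfl⟩ := (subsingleton_ext_one_iff_of_exact N I.injective_subtype
      (Submodule.mkQ_surjective I) (LinearMap.exact_subtype_mkQ I)).1 (h _) φ
    exact ⟨ψ, fun _ _ ↦ rfl⟩
  | succ n ih =>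
    have := Abelian.Ext.subsingleton_of_projective (ModuleCat.of A A) (ModuleCat.of A N) n
    exact ih (subsingleton_ext_of_succ h)

theorem injective_of_injectiveDimension_ne_top
    (hN : injectiveDimension (ModuleCat.of A N) ≠ ⊤) : Module.Injective A N := by
  obtain ⟨n, hn⟩ := (injectiveDimension_ne_top_iff _).1 hN
  exact injective_of_subsingleton_ext_succ fun X _ _ _ ↦
    HasInjectiveDimensionLT.subsingleton _ (n + 1) _ le_rfl (ModuleCat.of A X)

end

theorem isTorsionless_of_injective [Module.Injective A A] (N : Type*) [AddCommGroup N]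
    [Module A N] : IsTorsionless A N := by
  refine (injective_iff_map_eq_zero _).2 fun y hy ↦ by_contra fun hy0 ↦ ?_
  let t := LinearMap.toSpanSingleton A N y
  have ht : LinearMap.ker t ≠ ⊤ := fun h ↦ hy0 <| by
    simpa [t] using LinearMap.congr_fun (LinearMap.ker_eq_top.1 h) 1
  obtain ⟨m, hm, hle⟩ := Ideal.exists_le_maximal _ ht
  obtain ⟨f, hf⟩ := exists_injective_quotient_prime A m
  -- `A y → A / m → A` extends to a linear form on `N`, whose value at `y` is `f 1 ≠ 0`.
  obtain ⟨g, hg⟩ := Module.Injective.extension_property A A _ _ ((LinearMap.ker t).liftQ t le_rfl)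
    (LinearMap.ker_eq_bot.1 (Submodule.ker_liftQ_eq_bot' _ _ rfl)) (f ∘ₗ Submodule.factor hle)
  have hgy : g y = f 1 := calc
    g y = g (t 1) := by rw [LinearMap.toSpanSingleton_apply_one]
    _ = f 1 := LinearMap.congr_fun hg (Submodule.Quotient.mk 1)
  have hf1 : f 1 = f 0 := by rw [← hgy, map_zero]; exact LinearMap.congr_fun hy g
  exact one_ne_zero (hf hf1)

end Artinian

section Localization

variable {R : Type*} [CommRing R] {X : Type*} [AddCommGroup X] [Module R X]

theorem mkLinearMap_ne_zero_of_colon_le {p : Ideal R} [p.IsPrime] {y : X}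
    (hy : (⊥ : Submodule R X).colon {y} ≤ p) :
    LocalizedModule.mkLinearMap p.primeCompl X y ≠ 0 := by
  intro h
  obtain ⟨s, hs⟩ := (IsLocalizedModule.eq_zero_iff p.primeCompl _).1 h
  exact s.2 (hy (Submodule.mem_colon_singleton.2 ((Submodule.mem_bot R).2 hs)))

variable [IsNoetherianRing R] [Module.Finite R X]

theorem exists_dual_apply_ne_zero_of_localization {p : Ideal R} [p.IsPrime]
    (hp : IsTorsionless (Localization.AtPrime p) (LocalizedModule.AtPrime p X)) {y : X}
    (hy : LocalizedModule.mkLinearMap p.primeCompl X y ≠ 0) :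
    ∃ φ : Module.Dual R X, φ y ≠ 0 := by
  have := Module.finitePresentation_of_finite R X
  obtain ⟨g, hg⟩ : ∃ g : Module.Dual (Localization.AtPrime p) (LocalizedModule.AtPrime p X),
      g (LocalizedModule.mkLinearMap p.primeCompl X y) ≠ 0 := by
    by_contra! h
    exact hy ((injective_iff_map_eq_zero _).1 hp _ (LinearMap.ext h))
  obtain ⟨φ, s, hφ⟩ := Module.FinitePresentation.exists_lift_of_isLocalizedModule
    p.primeCompl (Algebra.linearMap R (Localization.AtPrime p))
    (g.restrictScalars R ∘ₗ LocalizedModule.mkLinearMap p.primeCompl X)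
  refine ⟨φ, fun h ↦ hg ?_⟩
  have hs : s • g (LocalizedModule.mkLinearMap p.primeCompl X y) = 0 := by
    simpa [h] using (LinearMap.congr_fun hφ y).symm
  exact IsLocalizedModule.smul_injective (Algebra.linearMap R (Localization.AtPrime p)) s
    (hs.trans (smul_zero s).symm)

theorem isTorsionless_of_localization
    (H : ∀ (p : Ideal R) [p.IsPrime], p ∈ associatedPrimes R X →
      IsTorsionless (Localization.AtPrime p) (LocalizedModule.AtPrime p X)) :
    IsTorsionless R X := by
  let K := LinearMap.ker (Module.Dual.eval R X)
  refine LinearMap.ker_eq_bot.1 (show K = ⊥ from ?_)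
  by_contra hK
  have := Submodule.nontrivial_iff_ne_bot.2 hK
  obtain ⟨p, hpK⟩ := associatedPrimes.nonempty R K
  have := hpK.isPrime
  have hpX : p ∈ associatedPrimes R X := hpK.map_of_injective K.subtype K.injective_subtype
  obtain ⟨-, y, hy⟩ := isAssociatedPrime_iff.1 hpK
  have hy' : (⊥ : Submodule R X).colon {(y : X)} ≤ p := by
    rw [hy]
    intro a ha
    simpa [Submodule.mem_colon_singleton, Subtype.ext_iff] using ha
  obtain ⟨φ, hφ⟩ := exists_dual_apply_ne_zero_of_localization (H p hpX)
    (mkLinearMap_ne_zero_of_colon_le hy')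
  exact hφ (LinearMap.congr_fun y.2 φ)

end Localization

section Depth

section

variable {A : Type u} [CommRing A] [IsLocalRing A] {M N : Type u} [AddCommGroup M] [Module A M]
  [AddCommGroup N] [Module A N]

theorem moduleDepth_congr (e : M ≃ₗ[A] N) : moduleDepth A M = moduleDepth A N := by
  simp only [moduleDepth, e.isWeaklyRegular_congr]

theorem moduleDepth_eq_zero_of_maximalIdeal_mem_associatedPrimes
    (hM : IsLocalRing.maximalIdeal A ∈ associatedPrimes A M) : moduleDepth A M = 0 := by
  refine le_antisymm (iSup_le fun rs ↦ iSup_le fun hrs ↦ iSup_le fun hreg ↦ ?_) bot_le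
  obtain _ | ⟨r, rs⟩ := rs
  · simp
  obtain ⟨hprime, y, hy⟩ := hM
  have hr : IsSMulRegular M r := ((RingTheory.Sequence.isWeaklyRegular_cons_iff M r rs).1 hreg).1
  obtain ⟨n, hn⟩ : ∃ n, r ^ n ∈ (⊥ : Submodule A M).colon {y} := by
    have := hrs r List.mem_cons_self
    rwa [hy] at this
  have hy0 : y = 0 := (hr.pow n).right_eq_zero_of_smul
    ((Submodule.mem_bot A).1 (Submodule.mem_colon_singleton.1 hn))
  exact absurd (hy.trans (by simp [hy0])) hprime.ne_top

end

variable {R : Type u} [CommRing R] {X : Type u} [AddCommGroup X] [Module R X]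

theorem depthAt_self (p : Ideal R) [p.IsPrime] :
    depthAt R p R = moduleDepth (Localization.AtPrime p) (Localization.AtPrime p) :=
  moduleDepth_congr ((IsLocalizedModule.linearEquiv p.primeCompl
    (LocalizedModule.mkLinearMap p.primeCompl R)
    (Algebra.linearMap R (Localization.AtPrime p))).extendScalarsOfIsLocalization p.primeCompl
      (Localization.AtPrime p))

theorem depthAt_eq_zero_of_mem_associatedPrimes {p : Ideal R} [p.IsPrime]
    (hp : p ∈ associatedPrimes R X) : depthAt R p X = 0 :=
  moduleDepth_eq_zero_of_maximalIdeal_mem_associatedPrimes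
    (Module.associatedPrimes.mem_associatedPrimes_atPrime_of_mem_associatedPrimes hp)

theorem mem_minimalPrimes_of_mem_associatedPrimes (hR : SatisfiesSerre R 1 R)
    (hX : SatisfiesSerreTilde R 1 X) {p : Ideal R} [p.IsPrime] (hp : p ∈ associatedPrimes R X) :
    p ∈ minimalPrimes R := by
  have hdepth : moduleDepth (Localization.AtPrime p) (Localization.AtPrime p) = 0 := by
    simpa [depthAt_eq_zero_of_mem_associatedPrimes hp] using hX p
  have hdim : p.height = 0 := by
    have := hR p
    rw [depthAt_self, hdepth, IsLocalization.AtPrime.ringKrullDim_eq_height p] at this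
    have : min 1 p.height ≤ 0 := by exact_mod_cast this
    simpa using this
  exact Ideal.height_eq_zero_iff.1 hdim

theorem SatisfiesSerre.mono {m n : ℕ} (hmn : m ≤ n) (hX : SatisfiesSerre R n X) :
    SatisfiesSerre R m X :=
  fun p _ ↦ (min_le_min_right _ (by exact_mod_cast hmn)).trans (hX p)

theorem satisfiesSerre_of_ringKrullDim_le_zero (hR : ringKrullDim R ≤ 0) (n : ℕ) :
    SatisfiesSerre R n X := by
  intro p _
  rw [IsLocalization.AtPrime.ringKrullDim_eq_height p]
  exact (min_le_right _ _).trans ((Ideal.height_le_ringKrullDim_of_isPrime.trans hR).trans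
    (by exact_mod_cast zero_le))

end Depth

theorem perpIsTorsionless_of_isGenericallyGorenstein {R : Type u} [CommRing R]
    [IsNoetherianRing R] (hG : IsGenericallyGorenstein R) (hS : SatisfiesSerre R 1 R)
    (hES : SatisfiesES R R 1) : PerpIsTorsionless R := by
  intro X _ _ _ hX
  refine isTorsionless_of_localization fun p _ hpX ↦ ?_
  have hp := mem_minimalPrimes_of_mem_associatedPrimes hS (hES X hX) hpX
  have := Ring.KrullDimLE.of_isLocalization p hp (Localization.AtPrime p)
  have : IsArtinianRing (Localization.AtPrime p) :=
    isArtinianRing_iff_isNoetherianRing_krullDimLE_zero.2 ⟨inferInstance, this⟩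
  have := injective_of_injectiveDimension_ne_top (hG p hp).2
  exact isTorsionless_of_injective _

theorem corollary4p4_general (R : Type u) [CommRing R] [IsNoetherianRing R]
    (hG : IsGenericallyGorenstein R) (hS : SatisfiesSerre R 1 R) (hES : SatisfiesES R R 1)
    (M : Type u) [AddCommGroup M] [Module R M] [Module.Finite R M] (hM : ExtPosVanishes R M R) :
    IsTotallyReflexive R M :=
  (perpIsTorsionless_of_isGenericallyGorenstein hG hS hES).isTotallyReflexive hM

theorem corollary4p4 (R : Type u) [CommRing R] [IsLocalRing R] [IsNoetherianRing R]
    (d : ℕ) (hdepth : moduleDepth R R = (d : ℕ∞))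
    (hd : 0 < d ∨ ringKrullDim R = 0)
    (hG : IsGenericallyGorenstein R)
    (hS : SatisfiesSerre R d R)
    (hES : SatisfiesES R R 1)
    (M : Type u) [AddCommGroup M] [Module R M] [Module.Finite R M]
    (hM : ExtPosVanishes R M R) :
    IsTotallyReflexive R M :=
  corollary4p4_general R hG
    (hd.elim (hS.mono ·) (satisfiesSerre_of_ringKrullDim_le_zero ·.le 1)) hES M hM
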